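/- Let $G=\mathrm{SL}_3(\mathbb R)$ with its usual topology, let $z\in\mathbb C$, $z\neq 0$, and let $$W_{1,2}^z=\left\{\begin{pmatrix} e^{zt} & 0\\ 0 & e^{-2\operatorname{Re}(z)t}\end{pmatrix} : t\in\mathbb R\right\}\le G,$$ where $e^{zt}=u+iv$ ($u,v\in\mathbb R$) stands for the $2\times 2$ block $\begin{pmatrix} u & v\\ -v & u\end{pmatrix}$. Suppose that $L\le G$ is a subgroup and $(p_n)$ a sequence in $G$ such that the conjugates $H_n=p_nW_{1,2}^zp_n^{-1}$ converge to $L$ in the Chabauty sense, that is: (1) every $h\in L$ is the limit of some sequence $(h_n)$ with $h_n\in H_n$ for all $n$; (2) whenever $h_n\in H_n$ for all $n$ and a subsequence of $(h_n)$ converges in $G$ to some $h$, then $h\in L$. Then $L$ is a closed subgroup of $G$ of dimension exactly $1$ as a Lie group, i.e. its Lie algebra $\{X\in M_3(\mathbb R): \exp(tX)\in L \text{ for all } t\in\mathbb R\}$ is $1$-dimensional. -/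

import Mathlib

open Filter Topology

noncomputable section

/-- Chabauty convergence of a sequence of subgroups `H n` of a topological group to a subgroup `L`:
every element of `L` is a limit of elements `h n ∈ H n`, and every limit of a subsequence of a
sequence `h n ∈ H n` lies in `L`. -/
def ChabautyTendsto {G : Type*} [Group G] [TopologicalSpace G]
    (H : ℕ → Subgroup G) (L : Subgroup G) : Prop :=
  (∀ x ∈ L, ∃ h : ℕ → G, (∀ n, h n ∈ H n) ∧ Tendsto h atTop (𝓝 x)) ∧
  (∀ h : ℕ → G, (∀ n, h n ∈ H n) → ∀ φ : ℕ → ℕ, StrictMono φ →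
    ∀ x : G, Tendsto (h ∘ φ) atTop (𝓝 x) → x ∈ L)

/-- The conjugate `g H g⁻¹` of a subgroup. -/
def conjSubgroup {G : Type*} [Group G] (g : G) (H : Subgroup G) : Subgroup G :=
  H.map (MulAut.conj g).toMonoidHom

/-- `L` is a conjugacy limit of `H`: some sequence of conjugates `p n * H * (p n)⁻¹` converges
to `L` in the Chabauty sense. -/
def IsConjugacyLimit {G : Type*} [Group G] [TopologicalSpace G] (H L : Subgroup G) : Prop :=
  ∃ p : ℕ → G, ChabautyTendsto (fun n => conjSubgroup (p n) H) L

/-- The subgroup `L` of `SL_n(ℝ)` is closed (hence an embedded Lie subgroup), and its Lie algebra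
`{X | exp (t X) ∈ L for all real t}` is a `d`-dimensional linear
subspace of the `n × n` matrices; that is, `L` is a Lie group of
dimension `d`. -/
def IsClosedOfLieDim {n : ℕ} (L : Subgroup (Matrix.SpecialLinearGroup (Fin n) ℝ)) (d : ℕ) :
    Prop :=
  IsClosed (L : Set (Matrix.SpecialLinearGroup (Fin n) ℝ)) ∧
  ∃ 𝔩 : Submodule ℝ (Matrix (Fin n) (Fin n) ℝ),
    (∀ X : Matrix (Fin n) (Fin n) ℝ,
      X ∈ 𝔩 ↔ ∀ t : ℝ, ∃ g ∈ L, (g : Matrix (Fin n) (Fin n) ℝ) = NormedSpace.exp (t • X)) ∧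
    Module.finrank ℝ 𝔩 = d

/-- The matrix `diag(e^{zt}, e^{-2 Re(z) t})`, where a complex number `s + i t` is written as the
`2 × 2` block with rows `(s, t)` and `(-t, s)`. -/
def W12Matrix (z : ℂ) (t : ℝ) : Matrix (Fin 3) (Fin 3) ℝ :=
  !![(Complex.exp (z * t)).re, (Complex.exp (z * t)).im, 0;
     -(Complex.exp (z * t)).im, (Complex.exp (z * t)).re, 0;
     0, 0, Real.exp (-2 * z.re * t)]

theorem W12Matrix_det (z : ℂ) (t : ℝ) : (W12Matrix z t).det = 1 := by
  have h : (Complex.exp (z * t)).re ^ 2 + (Complex.exp (z * t)).im ^ 2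
      = Real.exp (2 * z.re * t) := by
    have h1 := Complex.normSq_eq_norm_sq (Complex.exp (z * t))
    rw [Complex.norm_exp, Complex.normSq_apply, ← Real.exp_nat_mul] at h1
    have h2 : ((2 : ℕ) : ℝ) * (z * t).re = 2 * z.re * t := by
      simp [Complex.mul_re]; ring
    rw [h2] at h1
    linarith
  have h3 : Real.exp (2 * z.re * t) * Real.exp (-2 * z.re * t) = 1 := by
    rw [← Real.exp_add, ← Real.exp_zero]; congr 1; ring
  rw [← h] at h3
  simp only [W12Matrix, Matrix.det_fin_three, Matrix.of_apply, Matrix.cons_val]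
  linarith

theorem W12Matrix_add (z : ℂ) (s t : ℝ) :
    W12Matrix z (s + t) = W12Matrix z s * W12Matrix z t := by
  have h : Complex.exp (z * ((s + t : ℝ) : ℂ)) = Complex.exp (z * s) * Complex.exp (z * t) := by
    rw [← Complex.exp_add]; congr 1; push_cast; ring
  have h' : Real.exp (-2 * z.re * (s + t)) = Real.exp (-2 * z.re * s) * Real.exp (-2 * z.re * t) := by
    rw [← Real.exp_add]; congr 1; ring
  unfold W12Matrix
  rw [h, h']
  ext i j
  fin_cases i <;> fin_cases j <;>
    simp [Matrix.mul_apply, Fin.sum_univ_three, Complex.mul_re, Complex.mul_im] <;> ring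

/-- The one-parameter homomorphism `t ↦ diag(e^{zt}, e^{-2 Re(z) t})` into `SL_3(ℝ)`. -/
def W12Hom (z : ℂ) : Multiplicative ℝ →* Matrix.SpecialLinearGroup (Fin 3) ℝ :=
  MonoidHom.mk' (fun t => ⟨W12Matrix z t.toAdd, W12Matrix_det z t.toAdd⟩)
    (fun s t => Subtype.ext (W12Matrix_add z s.toAdd t.toAdd))

/-- The one-parameter subgroup `W_{1,2}^z = {diag(e^{zt}, e^{-2 Re(z) t}) : t ∈ ℝ}`
of `SL_3(ℝ)`. -/
def W12 (z : ℂ) : Subgroup (Matrix.SpecialLinearGroup (Fin 3) ℝ) :=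
  (W12Hom z).range

end

/-! The conjugates are lines exp(ℝ Xₙ), and some subsequence of Xₙ/‖Xₙ‖ tends to a unit vector Y;
condition (2) puts exp(ℝY) in L. Conversely, if exp(ℝZ) ⊆ L, then exp(sZ) for small s ≠ 0 is a limit
of exp(tₙXₙ). If tₙ‖Xₙ‖ can be kept small, a further subsequence gives exp(sZ) = exp(cY), and
injectivity of exp near 0 gives Z ∈ ℝY (`exists_generator_line`). The danger is that exp(tXₙ) is
close to 1 only for large t‖Xₙ‖. `eventually_exists_log` excludes it uniformly in the conjugation:
eigenvalues near 1 are conjugation invariant and make the logarithm series converge to some tXₙ,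
whose norm is then bounded through M - 1 alone. -/

theorem exists_injOn_exp_ball (𝔸 : Type*) [NormedRing 𝔸] [NormedAlgebra ℝ 𝔸] [CompleteSpace 𝔸] :
    ∃ ε > 0, Set.InjOn (NormedSpace.exp : 𝔸 → 𝔸) (Metric.ball 0 ε) := by
  have h : HasStrictFDerivAt (NormedSpace.exp : 𝔸 → 𝔸)
      ((ContinuousLinearEquiv.refl ℝ 𝔸 : 𝔸 ≃L[ℝ] 𝔸) : 𝔸 →L[ℝ] 𝔸) 0 :=
    hasStrictFDerivAt_exp_zero (𝕂 := ℝ)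
  obtain ⟨ε, hε, hb⟩ := Metric.isOpen_iff.1 (h.toOpenPartialHomeomorph _).open_source 0
    h.mem_toOpenPartialHomeomorph_source
  exact ⟨ε, hε, (h.toOpenPartialHomeomorph _).injOn.mono hb⟩

theorem norm_le_of_hasSum_log {𝔸 : Type*} [NormedRing 𝔸] [NormedAlgebra ℝ 𝔸] {x y : 𝔸}
    (hx : ‖x‖ ≤ 1 / 2)
    (h : HasSum (fun k : ℕ => ((-1 : ℝ) ^ (k + 1) / k) • x ^ k) y) : ‖y‖ ≤ 2 * ‖x‖ := by
  have hx' : ‖x‖ < 1 := by linarith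
  -- The k = 0 term is zero because division by 0 gives 0; the rest is dominated by ‖x‖/(1 - ‖x‖).
  rw [← hasSum_nat_add_iff' 1] at h
  simp only [Finset.range_one, Finset.sum_singleton, Nat.cast_zero, div_zero, zero_smul,
    sub_zero] at h
  have hg := (hasSum_geometric_of_lt_one (norm_nonneg x) hx').mul_left ‖x‖
  have hb : ∀ k : ℕ, ‖((-1 : ℝ) ^ (k + 1 + 1) / ((k + 1 : ℕ) : ℝ)) • x ^ (k + 1)‖
      ≤ ‖x‖ * ‖x‖ ^ k := fun k => by
    rw [norm_smul, ← pow_succ']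
    refine (mul_le_of_le_one_left (norm_nonneg _) ?_).trans (norm_pow_le' x k.succ_pos)
    rw [norm_div, norm_pow, norm_neg, norm_one, one_pow, Real.norm_natCast]
    exact div_le_one_of_le₀ (by push_cast; linarith [(Nat.cast_nonneg k : (0 : ℝ) ≤ k)])
      (Nat.cast_nonneg _)
  refine (h.norm_le_of_bounded hg hb).trans ?_
  rw [← div_eq_mul_inv, div_le_iff₀ (by linarith)]
  nlinarith [norm_nonneg x]

/-- Let one-parameter groups `t ↦ exp (t X n)` converge to a set `S`, and suppose that an element of
any of them close to `1` has a logarithm close to `0` on the line through `X n`. Then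
the infinitesimal generators of one-parameter groups in `S` form a line. -/
theorem exists_generator_line {𝔸 : Type*} [NormedRing 𝔸] [NormedAlgebra ℝ 𝔸] [FiniteDimensional ℝ 𝔸]
    (X : ℕ → 𝔸) (hX : ∀ n, X n ≠ 0) (S : Set 𝔸)
    (hlim : ∀ g ∈ S, ∃ h : ℕ → 𝔸, (∀ n, ∃ t : ℝ, h n = NormedSpace.exp (t • X n)) ∧
      Tendsto h atTop (𝓝 g))
    (hmem : ∀ h : ℕ → 𝔸, (∀ n, ∃ t : ℝ, h n = NormedSpace.exp (t • X n)) →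
      ∀ φ : ℕ → ℕ, StrictMono φ → ∀ x, Tendsto (h ∘ φ) atTop (𝓝 x) → x ∈ S)
    (hlog : ∀ᶠ M in 𝓝 (1 : 𝔸), ∀ (n : ℕ) (τ : ℝ), M = NormedSpace.exp (τ • X n) →
      ∃ t : ℝ, M = NormedSpace.exp (t • X n) ∧ ‖t • X n‖ ≤ 2 * ‖M - 1‖) :
    ∃ Y : 𝔸, Y ≠ 0 ∧ ∀ Z : 𝔸, Z ∈ Submodule.span ℝ {Y} ↔
      ∀ t : ℝ, NormedSpace.exp (t • Z) ∈ S := by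
  have : ProperSpace 𝔸 := FiniteDimensional.proper ℝ 𝔸
  have : CompleteSpace 𝔸 := FiniteDimensional.complete ℝ 𝔸
  let : NormedAlgebra ℚ 𝔸 := NormedAlgebra.restrictScalars ℚ ℝ 𝔸
  have hexp : Continuous (NormedSpace.exp : 𝔸 → 𝔸) := NormedSpace.exp_continuous
  have hnorm : ∀ n, ‖(‖X n‖⁻¹ : ℝ) • X n‖ = 1 := fun n => norm_smul_inv_norm (𝕜 := ℝ) (hX n)
  obtain ⟨Y, hY, φ, hφ, hYlim⟩ := (isCompact_sphere (0 : 𝔸) 1).tendsto_subseq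
    (x := fun n => (‖X n‖⁻¹ : ℝ) • X n) (fun n => by simpa using hnorm n)
  have hY1 : ‖Y‖ = 1 := by simpa using hY
  refine ⟨Y, fun h => by simp [h] at hY1, fun Z => ⟨fun hZ t => ?_, fun hZ => ?_⟩⟩
  · obtain ⟨c, rfl⟩ := Submodule.mem_span_singleton.1 hZ
    refine hmem (fun n => NormedSpace.exp ((t * c * ‖X n‖⁻¹) • X n)) (fun n => ⟨_, rfl⟩) φ hφ _ ?_
    have := (hexp.tendsto _).comp (hYlim.const_smul (t * c))
    simpa only [Function.comp_def, smul_smul] using this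
  · obtain ⟨ε, hε, hinj⟩ := exists_injOn_exp_ball 𝔸
    -- The factor 2 in `hlog` turns ε/4 into ε/2, so limits of the parameters stay inside the open
    -- ε-ball.
    have hnear : ∀ᶠ M in 𝓝 (1 : 𝔸), ‖M - 1‖ < ε / 4 := by
      filter_upwards [Metric.ball_mem_nhds (1 : 𝔸) (by positivity : 0 < ε / 4)] with M hM
      simpa [dist_eq_norm] using hM
    have hz0 : Tendsto (fun s : ℝ => s • Z) (𝓝 0) (𝓝 0) := by
      have : Continuous fun s : ℝ => s • Z := by fun_prop
      simpa using this.tendsto 0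
    have hz1 : Tendsto (fun s : ℝ => NormedSpace.exp (s • Z)) (𝓝 0) (𝓝 1) := by
      have := (hexp.tendsto 0).comp hz0
      rwa [NormedSpace.exp_zero] at this
    -- The conditions must hold on a whole neighbourhood of exp(sZ), since they are applied to `h n`
    -- and not to its limit.
    have hev := ((hz1.eventually (eventually_eventually_nhds.2 (hlog.and hnear))).and
      (hz0.eventually (Metric.ball_mem_nhds (0 : 𝔸) hε)))
    obtain ⟨s, ⟨hs1, hs2⟩, hs0⟩ :=
      ((hev.filter_mono nhdsWithin_le_nhds).and (self_mem_nhdsWithin (s := {(0 : ℝ)}ᶜ))).exists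
    obtain ⟨h, hh, hhlim⟩ := hlim _ (hZ s)
    have key : ∀ᶠ n in atTop, ∃ c ∈ Set.Icc (-(ε / 2)) (ε / 2),
        h n = NormedSpace.exp (c • ((‖X n‖⁻¹ : ℝ) • X n)) := by
      filter_upwards [hhlim.eventually hs1] with n hn
      obtain ⟨τ, hτ⟩ := hh n
      obtain ⟨t, ht, hb⟩ := hn.1 n τ hτ
      refine ⟨t * ‖X n‖, abs_le.1 ?_, ?_⟩
      · rw [norm_smul, Real.norm_eq_abs] at hb
        rw [abs_mul, abs_norm]
        linarith [hn.2]
      · rw [smul_smul, mul_assoc, mul_inv_cancel₀ (norm_ne_zero_iff.2 (hX n)), mul_one, ht]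
    obtain ⟨N, hN⟩ := eventually_atTop.1 (hφ.tendsto_atTop.eventually key)
    choose c hc hce using fun k => hN (k + N) (Nat.le_add_left _ _)
    obtain ⟨c₀, hc₀, ψ, hψ, hclim⟩ := isCompact_Icc.tendsto_subseq hc
    have hsub : Tendsto (fun k : ℕ => ψ k + N) atTop atTop :=
      tendsto_atTop_mono (fun k => Nat.le_add_right _ _) hψ.tendsto_atTop
    have l1 : Tendsto (fun k => h (φ (ψ k + N))) atTop (𝓝 (NormedSpace.exp (c₀ • Y))) := by
      have hY' : Tendsto (fun k => (‖X (φ (ψ k + N))‖⁻¹ : ℝ) • X (φ (ψ k + N))) atTop (𝓝 Y) :=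
        hYlim.comp hsub
      have := (hexp.tendsto _).comp (hclim.smul hY')
      refine this.congr fun k => ?_
      exact (hce (ψ k)).symm
    have l2 : Tendsto (fun k => h (φ (ψ k + N))) atTop (𝓝 (NormedSpace.exp (s • Z))) :=
      hhlim.comp (hφ.tendsto_atTop.comp hsub)
    have heq : c₀ • Y = s • Z := by
      refine hinj ?_ hs2 (tendsto_nhds_unique l1 l2)
      rw [mem_ball_zero_iff, norm_smul, hY1, mul_one, Real.norm_eq_abs]
      exact (abs_le.2 hc₀).trans_lt (by linarith)
    refine Submodule.mem_span_singleton.2 ⟨s⁻¹ * c₀, ?_⟩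
    rw [mul_smul, heq, smul_smul, inv_mul_cancel₀ hs0, one_smul]

theorem ChabautyTendsto.isClosed {G : Type*} [Group G] [TopologicalSpace G]
    [FirstCountableTopology G] {H : ℕ → Subgroup G} {L : Subgroup G} (h : ChabautyTendsto H L) :
    IsClosed (L : Set G) := by
  refine isClosed_of_closure_subset fun x hx => ?_
  obtain ⟨U, hU⟩ := (𝓝 x).exists_antitone_basis
  have hev : ∀ k, ∀ᶠ n in atTop, ∃ g ∈ H n, g ∈ U k := fun k => by
    obtain ⟨V, hVU, hV, hxV⟩ := mem_nhds_iff.1 (hU.mem k)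
    obtain ⟨y, hyV, hyL⟩ := mem_closure_iff.1 hx V hV hxV
    obtain ⟨g, hg, hlim⟩ := h.1 y hyL
    filter_upwards [hlim.eventually (hV.mem_nhds hyV)] with n hn
    exact ⟨g n, hg n, hVU hn⟩
  obtain ⟨φ, hφ, hφU⟩ := extraction_forall_of_eventually hev
  choose g hgH hgU using hφU
  -- Condition (2) wants a full sequence; indices outside the range of `φ` receive 1.
  refine h.2 (Function.extend φ g 1) (fun n => ?_) φ hφ x ?_
  · by_cases hn : ∃ k, φ k = n
    · obtain ⟨k, rfl⟩ := hn
      rw [hφ.injective.extend_apply]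
      exact hgH k
    · rw [Function.extend_apply' _ _ _ hn]
      exact one_mem _
  · rw [Function.extend_comp hφ.injective]
    exact hU.tendsto hgU

/-! ### Exponential and logarithm in the block algebra ℂ × ℝ -/

/-- The algebra of block diagonal matrices with a complex `2 × 2` block and a real `1 × 1` block. -/
def blockRingHom : ℂ × ℝ →+* Matrix (Fin 3) (Fin 3) ℝ where
  toFun x := !![x.1.re, x.1.im, 0; -x.1.im, x.1.re, 0; 0, 0, x.2]
  map_one' := by ext i j; fin_cases i <;> fin_cases j <;> simp
  map_zero' := by ext i j; fin_cases i <;> fin_cases j <;> simp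
  map_add' x y := by ext i j; fin_cases i <;> fin_cases j <;> simp [add_comm]
  map_mul' x y := by
    ext i j
    fin_cases i <;> fin_cases j <;>
      simp [Matrix.mul_apply, Fin.sum_univ_three] <;> ring

theorem blockRingHom_apply (x : ℂ × ℝ) :
    blockRingHom x = !![x.1.re, x.1.im, 0; -x.1.im, x.1.re, 0; 0, 0, x.2] := rfl

theorem blockRingHom_smul (t : ℝ) (x : ℂ × ℝ) : blockRingHom (t • x) = t • blockRingHom x := by
  ext i j; fin_cases i <;> fin_cases j <;> simp [blockRingHom_apply]

theorem continuous_blockRingHom : Continuous blockRingHom := by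
  refine continuous_matrix fun i j => ?_
  fin_cases i <;> fin_cases j <;> simp [blockRingHom_apply] <;> fun_prop

/-- The generator `diag(z, -2 Re z)` of `W12 z`. -/
noncomputable def W12Generator (z : ℂ) : Matrix (Fin 3) (Fin 3) ℝ :=
  blockRingHom (z, -2 * z.re)

theorem W12Generator_ne_zero {z : ℂ} (hz : z ≠ 0) : W12Generator z ≠ 0 := fun h => hz <| by
  have h0 := congrFun (congrFun h 0) 0
  have h1 := congrFun (congrFun h 0) 1
  simp [W12Generator, blockRingHom_apply] at h0 h1
  exact Complex.ext h0 h1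

theorem W12Matrix_eq_blockRingHom (z : ℂ) (t : ℝ) :
    W12Matrix z t = blockRingHom (Complex.exp (z * t), Real.exp (-2 * z.re * t)) := rfl

open scoped Matrix.Norms.Operator in
theorem map_exp_blockRingHom (x : ℂ × ℝ) :
    blockRingHom (NormedSpace.exp x) = NormedSpace.exp (blockRingHom x) := by
  let : NormedAlgebra ℚ ℂ := NormedAlgebra.restrictScalars ℚ ℝ ℂ
  exact NormedSpace.map_exp blockRingHom continuous_blockRingHom x

theorem exp_smul_W12Generator (z : ℂ) (t : ℝ) :
    NormedSpace.exp (t • W12Generator z) = W12Matrix z t := by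
  let : NormedAlgebra ℚ ℂ := NormedAlgebra.restrictScalars ℚ ℝ ℂ
  let : NormedAlgebra ℚ ℝ := NormedAlgebra.restrictScalars ℚ ℝ ℝ
  rw [W12Generator, ← blockRingHom_smul, ← map_exp_blockRingHom,
    W12Matrix_eq_blockRingHom]
  congr 1
  refine Prod.ext ?_ ?_
  · rw [Prod.fst_exp, ← Complex.exp_eq_exp_ℂ]
    simp [mul_comm]
  · rw [Prod.snd_exp, ← Real.exp_eq_exp_ℝ]
    simp [mul_comm]

theorem hasSum_log_real {x : ℝ} (hx : |x| < 1) :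
    HasSum (fun k : ℕ => (-1 : ℝ) ^ (k + 1) * x ^ k / k) (Real.log (1 + x)) := by
  have h := Complex.hasSum_taylorSeries_log (z := (x : ℂ)) (by simpa using hx)
  have h2 : Complex.log (1 + x) = ((Real.log (1 + x) : ℝ) : ℂ) := by
    rw [Complex.ofReal_log (by linarith [(abs_lt.1 hx).1])]
    push_cast
    rfl
  rw [h2] at h
  exact_mod_cast h

/-- The scalar logarithm series in ℂ and ℝ are carried over by `blockRingHom`; `hlog` says that the
principal branch returns zt itself. -/
theorem hasSum_log_W12Matrix {z : ℂ} {t : ℝ} (hlog : Complex.log (Complex.exp (z * t)) = z * t)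
    (hw : ‖Complex.exp (z * t) - 1‖ < 1) (hr : |Real.exp (-2 * z.re * t) - 1| < 1) :
    HasSum (fun k : ℕ => ((-1 : ℝ) ^ (k + 1) / k) • (W12Matrix z t - 1) ^ k)
      (t • W12Generator z) := by
  have h1 := Complex.hasSum_taylorSeries_log hw
  have h2 := hasSum_log_real hr
  rw [add_sub_cancel, hlog] at h1
  rw [add_sub_cancel, Real.log_exp] at h2
  have h := (h1.prodMk h2).map blockRingHom continuous_blockRingHom
  convert h using 1
  · funext k
    rw [W12Matrix_eq_blockRingHom, ← map_one blockRingHom, ← map_sub, ← map_pow,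
      ← blockRingHom_smul, Function.comp_apply]
    congr 1
    refine Prod.ext ?_ ?_
    · simp only [Prod.smul_fst, Prod.pow_fst, Prod.fst_sub, Prod.fst_one, Complex.real_smul]
      push_cast
      ring
    · simp only [Prod.smul_snd, Prod.pow_snd, Prod.snd_sub, Prod.snd_one, smul_eq_mul]
      ring
  · rw [W12Generator, ← blockRingHom_smul]
    congr 1
    refine Prod.ext ?_ ?_
    · simp [mul_comm]
    · simp [mul_comm]

/-! ### Conjugation-invariant control of the eigenvalues -/

theorem trace_W12Matrix (z : ℂ) (t : ℝ) :
    (W12Matrix z t).trace = 2 * (Complex.exp (z * t)).re + Real.exp (-2 * z.re * t) := by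
  simp [W12Matrix, Matrix.trace_fin_three]; ring

theorem mem_spectrum_W12Matrix_sub_one (z : ℂ) (t : ℝ) :
    Real.exp (-2 * z.re * t) - 1 ∈ spectrum ℝ (W12Matrix z t - 1) := by
  rw [spectrum.mem_iff, Matrix.isUnit_iff_isUnit_det]
  simp [Matrix.algebraMap_eq_diagonal, W12Matrix, Matrix.det_fin_three, Matrix.diagonal]

theorem normSq_exp_mul_exp (z : ℂ) (t : ℝ) :
    ((Complex.exp (z * t)).re ^ 2 + (Complex.exp (z * t)).im ^ 2) * Real.exp (-2 * z.re * t)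
      = 1 := by
  have h := W12Matrix_det z t
  simp only [W12Matrix, Matrix.det_fin_three, Matrix.of_apply, Matrix.cons_val] at h
  linarith

/-- An element of `W12 z` whose eigenvalues are close to `1` has a small parameter. -/
theorem exists_log_exp_eq {z : ℂ} (hz : z ≠ 0) :
    ∃ η > 0, ∀ τ : ℝ, ‖Complex.exp (z * τ) - 1‖ < 1 → |Real.exp (-2 * z.re * τ) - 1| < η →
      ∃ t : ℝ, W12Matrix z t = W12Matrix z τ ∧
        Complex.log (Complex.exp (z * t)) = z * t := by
  by_cases ha : z.re = 0
  -- Here the group is a circle, so τ is replaced by the parameter of the principal argument.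
  · refine ⟨1, one_pos, fun τ hw _ => ?_⟩
    have hb : z.im ≠ 0 := fun h => hz (Complex.ext ha h)
    have hzI : z = z.im * Complex.I := by
      conv_lhs => rw [← Complex.re_add_im z, ha]
      simp
    set w := Complex.exp (z * τ) with hwdef
    have hw0 : w ≠ 0 := Complex.exp_ne_zero _
    have hwn : ‖w‖ = 1 := by rw [hwdef, Complex.norm_exp]; simp [ha]
    have hlw : Complex.log w = z * ((w.arg / z.im : ℝ) : ℂ) := by
      rw [Complex.log, hwn, Real.log_one, hzI]
      have : (z.im : ℂ) ≠ 0 := by exact_mod_cast hb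
      push_cast
      simp
      field_simp
    refine ⟨w.arg / z.im, ?_, ?_⟩
    · rw [W12Matrix_eq_blockRingHom, W12Matrix_eq_blockRingHom, ← hlw, Complex.exp_log hw0]
      simp [ha, hwdef]
    · rw [← hlw, Complex.exp_log hw0]
  -- Here the real eigenvalue r determines τ, and r near 1 forces |τ Im z| < π, so τ itself serves.
  · have hlog : Tendsto (fun r : ℝ => |Real.log r / (-2 * z.re) * z.im|) (𝓝 1) (𝓝 0) := by
      have : ContinuousAt (fun r : ℝ => |Real.log r / (-2 * z.re) * z.im|) 1 :=
        (((Real.continuousAt_log one_ne_zero).div_const _).mul_const _).abs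
      simpa [ContinuousAt] using this
    obtain ⟨η, hη, h⟩ := Metric.eventually_nhds_iff.1 (hlog.eventually (gt_mem_nhds Real.pi_pos))
    refine ⟨η, hη, fun τ _ hr => ⟨τ, rfl, ?_⟩⟩
    have h1 := h (y := Real.exp (-2 * z.re * τ)) (by rwa [Real.dist_eq])
    rw [Real.log_exp, mul_div_cancel_left₀ _ (by simpa using ha)] at h1
    have h2 := abs_lt.1 h1
    refine Complex.log_exp ?_ ?_ <;> simp <;> linarith [mul_comm z.im τ]

/-- |w - 1|² = |w|² - 2 Re w + 1, where |w|² ≤ 8/7 and 2 Re w > 7/4. -/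
theorem norm_sub_one_lt_one {w : ℂ} {r : ℝ} (hwr : (w.re ^ 2 + w.im ^ 2) * r = 1)
    (hr : |r - 1| < 1 / 8) (htr : |2 * w.re + r - 3| < 1 / 8) : ‖w - 1‖ < 1 := by
  rw [abs_lt] at hr htr
  have h1 : w.re ^ 2 + w.im ^ 2 ≤ 8 / 7 := by
    nlinarith [sq_nonneg w.re, sq_nonneg w.im]
  rw [← sq_lt_one_iff₀ (norm_nonneg _), ← Complex.normSq_eq_norm_sq, Complex.normSq_apply]
  simp only [Complex.sub_re, Complex.one_re, Complex.sub_im, Complex.one_im, sub_zero]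
  nlinarith

theorem blockRingHom_injective : Function.Injective blockRingHom := fun x y h => by
  have h0 := congrFun (congrFun h 0) 0
  have h1 := congrFun (congrFun h 0) 1
  have h2 := congrFun (congrFun h 2) 2
  exact Prod.ext (Complex.ext h0 h1) h2

/-- A matrix of determinant one as a unit of the matrix ring. -/
def Matrix.SpecialLinearGroup.toMatrixUnits {n : Type*} [Fintype n] [DecidableEq n]
    (p : Matrix.SpecialLinearGroup n ℝ) : (Matrix n n ℝ)ˣ where
  val := p
  inv := (p⁻¹ : Matrix.SpecialLinearGroup n ℝ)
  val_inv := by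
    rw [← Matrix.SpecialLinearGroup.coe_mul, mul_inv_cancel, Matrix.SpecialLinearGroup.coe_one]
  inv_val := by
    rw [← Matrix.SpecialLinearGroup.coe_mul, inv_mul_cancel, Matrix.SpecialLinearGroup.coe_one]

theorem exp_smul_conj_W12Generator (z : ℂ) (t : ℝ) (u : (Matrix (Fin 3) (Fin 3) ℝ)ˣ) :
    NormedSpace.exp (t • (u.val * W12Generator z * u.inv)) = u.val * W12Matrix z t * u.inv := by
  rw [← exp_smul_W12Generator]
  have h := Matrix.exp_units_conj u (t • W12Generator z)
  rw [mul_smul_comm, smul_mul_assoc] at h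
  exact h

open scoped Matrix.Norms.Operator in
/-- Elements close to `1` of a conjugate of `W12 z` have logarithms close to `0` on the conjugate
line, uniformly in the conjugating matrix. -/
theorem eventually_exists_log {z : ℂ} (hz : z ≠ 0) :
    ∀ᶠ M in 𝓝 (1 : Matrix (Fin 3) (Fin 3) ℝ), ∀ (u : (Matrix (Fin 3) (Fin 3) ℝ)ˣ) (τ : ℝ),
      M = u.val * W12Matrix z τ * u.inv → ∃ t : ℝ, M = u.val * W12Matrix z t * u.inv ∧
        ‖t • (u.val * W12Generator z * u.inv)‖ ≤ 2 * ‖M - 1‖ := by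
  obtain ⟨η, hη, hlog⟩ := exists_log_exp_eq hz
  have htr : Tendsto (fun M : Matrix (Fin 3) (Fin 3) ℝ => |M.trace - 3|) (𝓝 1) (𝓝 0) := by
    have h : Continuous fun M : Matrix (Fin 3) (Fin 3) ℝ => |M.trace - 3| := by fun_prop
    simpa using h.tendsto 1
  have hn : Tendsto (fun M : Matrix (Fin 3) (Fin 3) ℝ => ‖M - 1‖) (𝓝 1) (𝓝 0) := by
    have h : Continuous fun M : Matrix (Fin 3) (Fin 3) ℝ => ‖M - 1‖ := by fun_prop
    simpa using h.tendsto 1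
  filter_upwards [htr.eventually (gt_mem_nhds (by norm_num : (0 : ℝ) < 1 / 8)),
    hn.eventually (gt_mem_nhds (by norm_num : (0 : ℝ) < 1 / 8)),
    hn.eventually (gt_mem_nhds hη)] with M hM1 hM2 hM3 u τ hM
  have hconj : ∀ t, u.val * W12Matrix z t * u.inv - 1 = u.val * (W12Matrix z t - 1) * u.inv :=
    fun t => by rw [mul_sub, sub_mul, mul_one, u.val_inv]
  -- An eigenvalue is bounded by the operator norm, whatever the size of `u`.
  have hr : |Real.exp (-2 * z.re * τ) - 1| ≤ ‖M - 1‖ := by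
    refine spectrum.norm_le_norm_of_mem (𝕜 := ℝ) ?_
    rw [hM, hconj]
    have h := spectrum.units_conjugate (R := ℝ) (a := W12Matrix z τ - 1) (u := u)
    exact h ▸ mem_spectrum_W12Matrix_sub_one z τ
  have htrace : M.trace = 2 * (Complex.exp (z * τ)).re + Real.exp (-2 * z.re * τ) := by
    rw [hM, Matrix.trace_mul_cycle, u.inv_val, one_mul, trace_W12Matrix]
  rw [htrace] at hM1
  have hw := norm_sub_one_lt_one (normSq_exp_mul_exp z τ) (hr.trans_lt hM2) hM1
  obtain ⟨t, ht, hlt⟩ := hlog τ hw (hr.trans_lt hM3)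
  have ht' := ht
  rw [W12Matrix_eq_blockRingHom, W12Matrix_eq_blockRingHom, blockRingHom_injective.eq_iff,
    Prod.mk.injEq] at ht'
  have hs := hasSum_log_W12Matrix hlt (by rwa [ht'.1]) (by rw [ht'.2]; linarith)
  refine ⟨t, by rw [ht, hM], norm_le_of_hasSum_log (by linarith) ?_⟩
  -- Conjugating termwise yields the logarithm series of M itself, so no norm of `u` enters the
  -- bound.
  convert! (hs.mul_left u.val).mul_right u.inv using 1
  · funext k
    rw [hM, ← ht, hconj, mul_smul_comm, smul_mul_assoc]
    congr 1
    exact Units.conj_pow u _ k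
  · rw [mul_smul_comm, smul_mul_assoc]

theorem mem_conjSubgroup_W12 (z : ℂ) (p g : Matrix.SpecialLinearGroup (Fin 3) ℝ) :
    g ∈ conjSubgroup p (W12 z) ↔ ∃ t : ℝ, (g : Matrix (Fin 3) (Fin 3) ℝ) =
      NormedSpace.exp (t • (p.toMatrixUnits.val * W12Generator z * p.toMatrixUnits.inv)) := by
  simp only [exp_smul_conj_W12Generator]
  constructor
  · rintro ⟨_, ⟨t, rfl⟩, rfl⟩
    exact ⟨t.toAdd, rfl⟩
  · rintro ⟨t, ht⟩
    exact ⟨_, ⟨Multiplicative.ofAdd t, rfl⟩, Subtype.ext ht.symm⟩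

open scoped Matrix.Norms.Operator in
theorem mainTheorem3 (z : ℂ) (hz : z ≠ 0)
    (L : Subgroup (Matrix.SpecialLinearGroup (Fin 3) ℝ))
    (hL : IsConjugacyLimit (W12 z) L) :
    IsClosedOfLieDim L 1 := by
  obtain ⟨p, hp⟩ := hL
  have hemb : Topology.IsEmbedding
      (fun g : Matrix.SpecialLinearGroup (Fin 3) ℝ => (g : Matrix (Fin 3) (Fin 3) ℝ)) :=
    Topology.IsEmbedding.subtypeVal
  have : FirstCountableTopology (Matrix (Fin 3) (Fin 3) ℝ) :=
    inferInstanceAs (FirstCountableTopology (Fin 3 → Fin 3 → ℝ))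
  have : FirstCountableTopology (Matrix.SpecialLinearGroup (Fin 3) ℝ) :=
    hemb.isInducing.firstCountableTopology
  refine ⟨hp.isClosed, ?_⟩
  have hX : ∀ n, (p n).toMatrixUnits.val * W12Generator z * (p n).toMatrixUnits.inv ≠ 0 :=
    fun n h => W12Generator_ne_zero hz <| by
      have h1 : (p n).toMatrixUnits.val * W12Generator z = 0 :=
        (Units.mul_left_eq_zero (p n).toMatrixUnits⁻¹).1 h
      exact (Units.mul_right_eq_zero _).1 h1
  obtain ⟨Y, hY, h⟩ := exists_generator_line _ hX
    ((fun g : Matrix.SpecialLinearGroup (Fin 3) ℝ => (g : Matrix (Fin 3) (Fin 3) ℝ)) '' L)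
    (by
      rintro _ ⟨g, hg, rfl⟩
      obtain ⟨h, hh, hlim⟩ := hp.1 g hg
      exact ⟨fun n => h n, fun n => (mem_conjSubgroup_W12 z _ _).1 (hh n),
        (hemb.continuous.tendsto g).comp hlim⟩)
    (by
      intro h hh φ hφ x hx
      -- The limit is taken among all matrices; continuity of det keeps it in SL₃.
      have hdet : ∀ n, (h n).det = 1 := fun n => by
        obtain ⟨t, ht⟩ := hh n
        rw [ht.trans (exp_smul_conj_W12Generator z t _), Matrix.det_mul_right_comm, (p n).toMatrixUnits.val_inv,
          one_mul, W12Matrix_det]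
      have hxdet : x.det = 1 := by
        have hc : Continuous fun M : Matrix (Fin 3) (Fin 3) ℝ => M.det := by fun_prop
        refine tendsto_nhds_unique ((hc.tendsto x).comp hx) ?_
        simp only [Function.comp_def, hdet]
        exact tendsto_const_nhds
      exact ⟨⟨x, hxdet⟩, hp.2 (fun n => ⟨h n, hdet n⟩)
        (fun n => (mem_conjSubgroup_W12 z _ _).2 (hh n)) φ hφ _ (hemb.tendsto_nhds_iff.2 hx), rfl⟩)
    (by
      filter_upwards [eventually_exists_log hz] with M hM n τ hτ
      obtain ⟨t, ht, hb⟩ := hM _ τ (hτ.trans (exp_smul_conj_W12Generator z τ _))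
      exact ⟨t, ht.trans (exp_smul_conj_W12Generator z t _).symm, hb⟩)
  exact ⟨Submodule.span ℝ {Y}, h, finrank_span_singleton hY⟩
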